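/- For an integer $n\ge 1$ and reals $0\le r_1\le r_2\le 1/2$, let $\mathrm{VRG}(n,[r_1,r_2])$ be the random graph on the vertex set $\{1,\dots,n\}$ obtained as follows: let $X_1,\dots,X_n$ be independent and uniformly distributed on $[0,1]$, and join two distinct vertices $i\ne j$ by an edge if and only if $r_1\le d_L(X_i,X_j)\le r_2$, where $d_L(x,y)=\min\{|x-y|,\,1-|x-y|\}$ is the distance on the circle of circumference $1$ obtained by identifying the end points of $[0,1]$. Theorem. Let $a,b$ be real constants with $0\le b\le a$, and let $\log$ be the natural logarithm. (1) If $a>1$ and $a-b>1/2$, then the probability that $\mathrm{VRG}\big(n,[\tfrac{b\log n}{n},\tfrac{a\log n}{n}]\big)$ is connected tends to $1$ as $n\to\infty$. (2) If $a<1$ or $a-b<1/2$, then the probability that $\mathrm{VRG}\big(n,[\tfrac{b\log n}{n},\tfrac{a\log n}{n}]\big)$ is not connected tends to $1$ as $n\to\infty$. -/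

import Mathlib

open MeasureTheory Filter Topology

namespace VRG

/-- The circular (geodesic) distance between two points of `[0,1]`, the end points of which are
identified to form a circle of circumference `1`. -/
noncomputable def circDist (x y : ℝ) : ℝ := min |x - y| (1 - |x - y|)

theorem circDist_comm (x y : ℝ) : circDist x y = circDist y x := by
  unfold circDist
  rw [abs_sub_comm]

/-- The graph on `n` vertices placed at `X 0, …, X (n - 1)`: two distinct vertices are adjacent
if and only if their circular distance lies in `[r₁, r₂]`. -/
def graph (n : ℕ) (r₁ r₂ : ℝ) (X : Fin n → ℝ) : SimpleGraph (Fin n) where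
  Adj i j := i ≠ j ∧ r₁ ≤ circDist (X i) (X j) ∧ circDist (X i) (X j) ≤ r₂
  symm := ⟨fun i j h => by
    rw [circDist_comm (X j) (X i)]
    exact ⟨h.1.symm, h.2⟩⟩
  loopless := ⟨fun _ h => h.1 rfl⟩

/-- The uniform distribution on `[0,1]`. -/
noncomputable def unif : Measure ℝ := volume.restrict (Set.Icc (0 : ℝ) 1)

instance : IsProbabilityMeasure unif :=
  ⟨by simp [unif]⟩

/-- The joint law of the positions of the `n` vertices: independent and uniform on `[0,1]`. -/
noncomputable def positionLaw (n : ℕ) : Measure (Fin n → ℝ) := Measure.pi fun _ => unif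

instance (n : ℕ) : IsProbabilityMeasure (positionLaw n) := by
  unfold positionLaw
  infer_instance

/-- The probability that the vertex-random graph on `n` vertices with connectivity
interval `[r₁, r₂]` has the property `P`. -/
noncomputable def prob (n : ℕ) (r₁ r₂ : ℝ) (P : SimpleGraph (Fin n) → Prop) : ENNReal :=
  positionLaw n {X | P (graph n r₁ r₂ X)}

end VRG

/-! Connectivity. Fix a large integer `N` and cut the circle into about `N * n / log n` equal cells.
Points whose cell indices differ by between `B ≈ b * N` and `A ≈ a * N` are adjacent. A given set of
`N + 1` cells is empty with probability about `n ^ (-1 - 1 / N)`, and there are at most `n` windows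
of bounded length, so with high probability every window has at most `N` empty cells. The rest is
deterministic. Some run of `2 * A` consecutive cells is occupied in every block, and chains of step
`A` join one run to the next. Since the chains lie in distinct residue classes modulo `A`, blocking
all of them takes one empty cell per chain. Cutting two runs apart costs `A` empty cells, more than
`N` because `a > 1`; cutting a vertex off from the runs on both sides costs `2 * (A - B + 1)`, more
than `N` because `a - b > 1 / 2`. This is `exists_hub`; `one_le_prob_connected_add` is the union
bound.

Disconnection. About `n / log n` disjoint slots each hold a small cell and a region of measure `c *
log n / n` with `c < 1`. The expected number of slots with occupied cell and empty region is of
order at least `n ^ (1 - c) / log n` up to an arbitrarily small loss in the exponent, and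
Chebyshev's inequality produces two of them (`tendsto_prob_not_connected_of_slots`). If `a < 1`, the
region is a gap of length `r₂`, and two gaps cut the circle. If `a - b < 1 / 2`, the region covers
all possible neighbours of the cell, with `c` slightly above `2 * (a - b)`, and one such slot
already isolates a vertex. -/

namespace VRG

/-! ### Deterministic part: blocking chains of cells on the integer line -/

section Hub

variable {occ : ℤ → Prop} {r : ℤ → ℤ → Prop} {A B : ℤ}

/-- Cells of a fully occupied run of length `2 * A` are all related. -/
theorem rel_of_run (hr : Equivalence r) (hB : 1 ≤ B) (hBA : B < A)
    (adj : ∀ p q, occ p → occ q → B ≤ |p - q| → |p - q| ≤ A → r p q)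
    {j : ℤ} (run : ∀ i, j ≤ i → i < j + 2 * A → occ i) (i : ℤ) (hji : j ≤ i)
    (hi : i < j + 2 * A) : r j i := by
  induction i, hji using Int.leInduction with
  | base => exact hr.refl _
  | succ i hji ih =>
    have h1 : r j i := ih (by omega)
    refine hr.trans h1 ?_
    -- Cells `i` and `i + 1` need not be related directly. A jump of `A` and one back of `A - 1`,
    -- both in `[B, A]` since `B < A`, join them; the direction is the one that stays inside the
    -- run.
    by_cases h : i + A < j + 2 * A
    · refine hr.trans (adj i (i + A) (run _ hji (by omega)) (run _ (by omega) h) ?_ ?_)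
        (adj (i + A) (i + 1) (run _ (by omega) h) (run _ (by omega) hi) ?_ ?_)
      all_goals
        first
        | (rw [abs_of_nonneg (by omega)]; omega)
        | (rw [abs_of_nonpos (by omega)]; omega)
    · refine hr.trans (adj i (i + 1 - A) (run _ hji (by omega)) (run _ (by omega) (by omega)) ?_ ?_)
        (adj (i + 1 - A) (i + 1) (run _ (by omega) (by omega)) (run _ (by omega) hi) ?_ ?_)
      all_goals
        first
        | (rw [abs_of_nonneg (by omega)]; omega)
        | (rw [abs_of_nonpos (by omega)]; omega)

/-- An unblocked chain of step `A` going right reaches a fully occupied run. -/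
theorem rel_of_chain_right (hr : Equivalence r) (hB : 1 ≤ B) (hBA : B < A)
    (adj : ∀ p q, occ p → occ q → B ≤ |p - q| → |p - q| ≤ A → r p q)
    {x j : ℤ} (hxj : x ≤ j) (run : ∀ i, j ≤ i → i < j + 2 * A → occ i)
    (chain : ∀ y, x ≤ y → y < j + A → A ∣ y - x → occ y) : r x j := by
  have key : ∀ t : ℕ, x + t * A < j + A → r x (x + t * A) := by
    intro t
    induction t with
    | zero => intro _; simpa using hr.refl x
    | succ t ih =>
      intro ht
      push_cast at ht ⊢
      have h0 : 0 ≤ (t : ℤ) * A := by exact mul_nonneg (by positivity) (by omega)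
      refine hr.trans (ih (by linarith)) (adj _ _ (chain _ (by linarith) (by linarith) ⟨t, by ring⟩)
        (chain _ (by linarith) (by linarith) ⟨t + 1, by ring⟩) ?_ ?_)
      all_goals
        rw [abs_of_nonpos (by linarith)]; linarith
  have hA : 0 < A := by omega
  -- The quotient is `(j - x) / A` rounded up: it gives the first chain cell at or beyond `j`, which
  -- lies in the first half of the run.
  have h1 := Int.emod_add_mul_ediv (j - x + A - 1) A
  have h2 := Int.emod_nonneg (j - x + A - 1) hA.ne'
  have h3 := Int.emod_lt_of_pos (j - x + A - 1) hA
  have h4 : 0 ≤ (j - x + A - 1) / A := Int.ediv_nonneg (by omega) hA.le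
  obtain ⟨t, ht⟩ := Int.eq_ofNat_of_zero_le h4
  rw [ht, mul_comm] at h1
  exact hr.trans (key t (by linarith))
    (hr.symm (rel_of_run hr hB hBA adj run _ (by linarith) (by linarith)))

/-- An unblocked chain of step `A` going left reaches a fully occupied run. -/
theorem rel_of_chain_left (hr : Equivalence r) (hB : 1 ≤ B) (hBA : B < A)
    (adj : ∀ p q, occ p → occ q → B ≤ |p - q| → |p - q| ≤ A → r p q)
    {x j : ℤ} (hxj : j ≤ x) (run : ∀ i, j ≤ i → i < j + 2 * A → occ i)
    (chain : ∀ y, y ≤ x → j ≤ y → A ∣ y - x → occ y) : r x j := by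
  have key : ∀ t : ℕ, j ≤ x - t * A → r x (x - t * A) := by
    intro t
    induction t with
    | zero => intro _; simpa using hr.refl x
    | succ t ih =>
      intro ht
      push_cast at ht ⊢
      have h0 : 0 ≤ (t : ℤ) * A := by exact mul_nonneg (by positivity) (by omega)
      refine hr.trans (ih (by linarith)) (adj _ _ (chain _ (by linarith) (by linarith) ⟨-t, by ring⟩)
        (chain _ (by linarith) (by linarith) ⟨-(t + 1), by ring⟩) ?_ ?_)
      all_goals
        rw [abs_of_nonneg (by linarith)]; linarith
  have hA : 0 < A := by omega
  have h1 := Int.emod_add_mul_ediv (x - j) A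
  have h2 := Int.emod_nonneg (x - j) hA.ne'
  have h3 := Int.emod_lt_of_pos (x - j) hA
  have h4 : 0 ≤ (x - j) / A := Int.ediv_nonneg (by omega) hA.le
  obtain ⟨t, ht⟩ := Int.eq_ofNat_of_zero_le h4
  rw [ht, mul_comm] at h1
  exact hr.trans (key t (by linarith))
    (hr.symm (rel_of_run hr hB hBA adj run _ (by linarith) (by linarith)))

/-- If each of several chains of step `A` in distinct residue classes is blocked in a set `I`,
there are at least as many empty cells in `I`. -/
theorem exists_blocking {I S : Finset ℤ} (inj : ∀ s ∈ S, ∀ t ∈ S, A ∣ s - t → s = t)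
    (block : ∀ s ∈ S, ∃ e ∈ I, ¬ occ e ∧ A ∣ e - s) :
    ∃ T ⊆ I, (∀ e ∈ T, ¬ occ e) ∧ T.card = S.card := by
  choose! e he1 he2 he3 using block
  refine ⟨S.image e, ?_, ?_, Finset.card_image_of_injOn ?_⟩
  · intro y hy
    obtain ⟨s, hs, rfl⟩ := Finset.mem_image.1 hy
    exact he1 s hs
  · intro y hy
    obtain ⟨s, hs, rfl⟩ := Finset.mem_image.1 hy
    exact he2 s hs
  · intro s hs t ht hst
    refine inj s hs t ht ?_
    have h1 := dvd_sub (he3 t ht) (he3 s hs)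
    have h2 : e s = e t := hst
    have h3 : s - t = e t - t - (e s - s) := by linarith
    rwa [h3]

theorem eq_of_dvd_sub_of_mem_Icc {u s t : ℤ} (hs : u < s ∧ s ≤ u + A)
    (ht : u < t ∧ t ≤ u + A) (h : A ∣ s - t) : s = t := by
  have := Int.eq_zero_of_abs_lt_dvd h (by rw [abs_lt]; constructor <;> omega)
  omega

/-- In a configuration whose windows contain few empty cells there is a fully occupied run. -/
theorem exists_run (hA : 0 < A) {m : ℕ} {j : ℤ}
    (sparse : ∀ T ⊆ Finset.Ico j (j + 2 * A * m), (∀ t ∈ T, ¬ occ t) → T.card < m) :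
    ∃ c, j ≤ c ∧ c + 2 * A ≤ j + 2 * A * m ∧ ∀ i, c ≤ i → i < c + 2 * A → occ i := by
  by_contra! hcon
  have hk : ∀ k ∈ Finset.range m, ∃ i, j + 2 * A * k ≤ i ∧ i < j + 2 * A * k + 2 * A ∧ ¬ occ i := by
    intro k hk
    have hk' : (k : ℤ) + 1 ≤ m := by exact_mod_cast Finset.mem_range.1 hk
    refine hcon (j + 2 * A * k) ?_ ?_
    · have : 0 ≤ 2 * A * (k : ℤ) := by positivity
      linarith
    · nlinarith
  choose! e he1 he2 he3 using hk
  have hcard : ((Finset.range m).image e).card = m := by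
    rw [Finset.card_image_of_injOn, Finset.card_range]
    intro k hk l hl hkl
    have h1 := he1 k hk
    have h2 := he2 k hk
    have h3 := he1 l hl
    have h4 := he2 l hl
    rw [hkl] at h1 h2
    have h5 : (k : ℤ) < l + 1 := by
      by_contra! h
      nlinarith
    have h6 : (l : ℤ) < k + 1 := by
      by_contra! h
      nlinarith
    omega
  refine absurd hcard (sparse _ ?_ ?_).ne
  · intro y hy
    obtain ⟨k, hk, rfl⟩ := Finset.mem_image.1 hy
    have hk' : (k : ℤ) + 1 ≤ m := by exact_mod_cast Finset.mem_range.1 hk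
    have h1 := he1 k hk
    have h2 := he2 k hk
    have : 0 ≤ 2 * A * (k : ℤ) := by positivity
    rw [Finset.mem_Ico]
    constructor
    · linarith
    · nlinarith
  · intro y hy
    obtain ⟨k, hk, rfl⟩ := Finset.mem_image.1 hy
    exact he3 k hk

/-- If every long window contains few empty cells, then the occupied cells, two of which are
related whenever their distance is in `[B, A]`, have a hub to which every cell has access. -/
theorem exists_hub (hr : Equivalence r) (hB : 1 ≤ B) (hBA : B < A)
    (adj : ∀ p q, occ p → occ q → B ≤ |p - q| → |p - q| ≤ A → r p q)
    {m : ℕ} (hm : 1 ≤ m) (hmA : m ≤ A) (hmW : m ≤ 2 * (A - B + 1))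
    (sparse : ∀ j, ∀ T ⊆ Finset.Ico j (j + 10 * A * m), (∀ t ∈ T, ¬ occ t) → T.card < m) :
    ∃ c, ∀ p, ∃ q, occ q ∧ B ≤ |p - q| ∧ |p - q| ≤ A ∧ r q c := by
  have hA : 0 < A := by omega
  obtain ⟨D, hD⟩ : ∃ D : ℤ, D = 2 * A * m := ⟨_, rfl⟩
  have hm' : (1 : ℤ) ≤ m := by exact_mod_cast hm
  have hDA : 2 * A ≤ D := by nlinarith
  have sparse' : ∀ j u v, j ≤ u → v ≤ j + 5 * D → ∀ T ⊆ Finset.Ico u v, (∀ t ∈ T, ¬ occ t) →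
      T.card < m := by
    intro j u v hu hv T hT
    refine sparse j T (hT.trans (Finset.Ico_subset_Ico hu ?_))
    linarith
  have hrun : ∀ k : ℤ, ∃ c, k * D ≤ c ∧ c + 2 * A ≤ k * D + D ∧
      ∀ i, c ≤ i → i < c + 2 * A → occ i := by
    intro k
    rw [hD]
    refine exists_run hA (sparse' (k * (2 * A * m)) _ _ le_rfl ?_)
    linarith
  choose c hc1 hc2 hc3 using hrun
  have hstep : ∀ k, r (c k) (c (k + 1)) := by
    intro k
    by_contra hcon
    have e1 : (k + 1) * D = k * D + D := by ring
    have g1 := hc1 k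
    have g2 := hc2 k
    have g3 := hc1 (k + 1)
    have g4 := hc2 (k + 1)
    -- The first `A` cells of a run start `A` chains in distinct classes; blocking all of them needs
    -- `A ≥ m` empty cells.
    obtain ⟨T, hT1, hT2, hT3⟩ := exists_blocking (occ := occ) (A := A)
      (I := Finset.Ico (c k) (c (k + 1) + A)) (S := Finset.Ico (c k) (c k + A))
      (fun s hs t ht h => by
        rw [Finset.mem_Ico] at hs ht
        exact eq_of_dvd_sub_of_mem_Icc (u := c k - 1) (by omega) (by omega) h)
      (fun s hs => by
        rw [Finset.mem_Ico] at hs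
        by_contra! hno
        refine hcon (hr.trans (rel_of_run hr hB hBA adj (hc3 k) s hs.1 (by omega))
          (rel_of_chain_right hr hB hBA adj (by omega) (hc3 (k + 1)) ?_))
        intro y hy1 hy2 hy3
        by_contra hy
        exact hno y (Finset.mem_Ico.2 ⟨by omega, hy2⟩) hy hy3)
    have := sparse' (k * D) _ _ (by linarith) (by linarith) T hT1 hT2
    rw [hT3, Int.card_Ico] at this
    omega
  have hall : ∀ k, r (c k) (c 0) := by
    intro k
    induction k using Int.induction_on with
    | zero => exact hr.refl _
    | succ k ih => exact hr.trans (hr.symm (hstep k)) ih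
    | pred k ih =>
      refine hr.trans ?_ ih
      have := hstep (-k - 1)
      rwa [sub_add_cancel] at this
  refine ⟨c 0, fun p => ?_⟩
  by_contra! hcon
  have hD0 : 0 < D := by omega
  obtain ⟨k, hk⟩ : ∃ k : ℤ, k = p / D := ⟨_, rfl⟩
  have k1 : k * D ≤ p := by rw [hk]; exact Int.ediv_mul_le p hD0.ne'
  have k2 : p < k * D + D := by
    have := Int.lt_ediv_add_one_mul_self p hD0
    rw [hk]; linarith
  -- Runs two blocks away are used because those next door might begin before `p + A` or end after
  -- `p - A`. The five blocks from `k - 2` to `k + 2` make up the window length `10 * A * m`.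
  have e1 : (k + 2) * D = k * D + 2 * D := by ring
  have e2 : (k - 2) * D = k * D - 2 * D := by ring
  have g1 := hc1 (k + 2)
  have g2 := hc2 (k + 2)
  have g3 := hc1 (k - 2)
  have g4 := hc2 (k - 2)
  obtain ⟨T, hT1, hT2, hT3⟩ := exists_blocking (occ := occ) (A := A)
    (I := Finset.Ico (p + 1) (c (k + 2) + A)) (S := Finset.Icc (p + B) (p + A))
    (fun s hs t ht h => by
      rw [Finset.mem_Icc] at hs ht
      exact eq_of_dvd_sub_of_mem_Icc (u := p) (by omega) (by omega) h)
    (fun s hs => by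
      rw [Finset.mem_Icc] at hs
      by_contra! hno
      have hch : ∀ y, s ≤ y → y < c (k + 2) + A → A ∣ y - s → occ y := by
        intro y hy1 hy2 hy3
        by_contra hy
        exact hno y (Finset.mem_Ico.2 ⟨by omega, hy2⟩) hy hy3
      refine hcon s (hch s le_rfl (by linarith) (by simp)) ?_ ?_
        (hr.trans (rel_of_chain_right hr hB hBA adj (by linarith) (hc3 (k + 2)) hch) (hall _))
      all_goals rw [abs_of_nonpos (by omega)]; omega)
  obtain ⟨U, hU1, hU2, hU3⟩ := exists_blocking (occ := occ) (A := A)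
    (I := Finset.Ico (c (k - 2)) p) (S := Finset.Icc (p - A) (p - B))
    (fun s hs t ht h => by
      rw [Finset.mem_Icc] at hs ht
      exact eq_of_dvd_sub_of_mem_Icc (u := p - A - 1) (by omega) (by omega) h)
    (fun s hs => by
      rw [Finset.mem_Icc] at hs
      by_contra! hno
      have hch : ∀ y, y ≤ s → c (k - 2) ≤ y → A ∣ y - s → occ y := by
        intro y hy1 hy2 hy3
        by_contra hy
        exact hno y (Finset.mem_Ico.2 ⟨hy2, by omega⟩) hy hy3
      refine hcon s (hch s le_rfl (by linarith) (by simp)) ?_ ?_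
        (hr.trans (rel_of_chain_left hr hB hBA adj (by linarith) (hc3 (k - 2)) hch) (hall _))
      all_goals rw [abs_of_nonneg (by omega)]; omega)
  have hdisj : Disjoint T U := by
    rw [Finset.disjoint_left]
    intro y hy hy'
    have h1 := Finset.mem_Ico.1 (hT1 hy)
    have h2 := Finset.mem_Ico.1 (hU1 hy')
    omega
  -- The blockers lie on opposite sides of `p`, so their numbers add up to `2 * (A - B + 1) ≥ m`.
  have hTU := sparse' ((k - 2) * D) (c (k - 2)) (c (k + 2) + A) (by linarith) (by linarith)
    (T ∪ U) (Finset.union_subset (hT1.trans (Finset.Ico_subset_Ico (by linarith) le_rfl))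
      (hU1.trans (Finset.Ico_subset_Ico le_rfl (by linarith))))
    (fun t ht => (Finset.mem_union.1 ht).elim (hT2 t) (hU2 t))
  rw [Finset.card_union_of_disjoint hdisj, hT3, hU3, Int.card_Icc, Int.card_Icc] at hTU
  omega

end Hub

/-! ### From cells to the graph -/

section Sufficient

/-- The circular distance is the distance from `x - y` to the nearest integer, and only `-1`, `0`,
`1` can be within `1 / 2` of a number in `[-1, 1]`. -/
theorem circDist_eq_abs {x y : ℝ} (hx : x ∈ Set.Icc (0 : ℝ) 1) (hy : y ∈ Set.Icc (0 : ℝ) 1)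
    {k : ℤ} (h : |x - y - k| ≤ 1 / 2) : circDist x y = |x - y - k| := by
  obtain ⟨hx0, hx1⟩ := hx
  obtain ⟨hy0, hy1⟩ := hy
  obtain ⟨h1, h2⟩ := abs_le.1 h
  have k1 : (-2 : ℤ) < k := by
    have : (-2 : ℝ) < k := by linarith
    exact_mod_cast this
  have k2 : k < (2 : ℤ) := by
    have : (k : ℝ) < 2 := by linarith
    exact_mod_cast this
  unfold circDist
  obtain rfl | rfl | rfl : k = -1 ∨ k = 0 ∨ k = 1 := by omega
  · push_cast at *
    rw [abs_of_nonpos (by linarith : x - y ≤ 0), abs_of_nonneg (by linarith), min_eq_right]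
    all_goals linarith
  · push_cast at *
    rw [sub_zero] at *
    rw [min_eq_left]
    linarith
  · push_cast at *
    rw [abs_of_nonneg (by linarith : 0 ≤ x - y), abs_of_nonpos (by linarith), min_eq_right]
    all_goals linarith

/-- Points in cells of width `1 / M` whose indices differ by between `B` and `A` modulo `M`. -/
theorem circDist_bounds_of_cells {x y : ℝ} (hx : x ∈ Set.Icc (0 : ℝ) 1)
    (hy : y ∈ Set.Icc (0 : ℝ) 1) {M : ℕ} (hM : 0 < M) {p q A B : ℤ}
    (hp : (M : ℤ) ∣ ⌊M * x⌋ - p) (hq : (M : ℤ) ∣ ⌊M * y⌋ - q) (hB : B ≤ |p - q|)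
    (hA : |p - q| ≤ A) (hA2 : (A + 1 : ℝ) / M ≤ 1 / 2) :
    (B - 1 : ℝ) / M < circDist x y ∧ circDist x y ≤ (A + 1 : ℝ) / M := by
  obtain ⟨u, hu⟩ := hp
  obtain ⟨v, hv⟩ := hq
  have hM' : (0 : ℝ) < M := by exact_mod_cast hM
  have hB' : (B : ℝ) ≤ |(p : ℝ) - q| := by exact_mod_cast hB
  have hA' : |(p : ℝ) - q| ≤ A := by exact_mod_cast hA
  have hu' : (⌊M * x⌋ : ℝ) - p = M * u := by exact_mod_cast hu
  have hv' : (⌊M * y⌋ : ℝ) - q = M * v := by exact_mod_cast hv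
  have hθ : |Int.fract (M * x) - Int.fract (M * y)| < 1 := by
    have h1 := Int.fract_nonneg (M * x)
    have h2 := Int.fract_lt_one (M * x)
    have h3 := Int.fract_nonneg (M * y)
    have h4 := Int.fract_lt_one (M * y)
    rw [abs_lt]
    constructor <;> linarith
  have e : x - y - ((u - v : ℤ) : ℝ)
      = ((p - q : ℝ) + (Int.fract (M * x) - Int.fract (M * y))) / M := by
    have h1 := Int.floor_add_fract (M * x)
    have h2 := Int.floor_add_fract (M * y)
    rw [eq_div_iff hM'.ne']
    push_cast
    linarith
  have h1 := abs_add_le (p - q : ℝ) (Int.fract (M * x) - Int.fract (M * y))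
  have h2 := abs_sub_abs_le_abs_add (p - q : ℝ) (Int.fract (M * x) - Int.fract (M * y))
  have h3 : |x - y - ((u - v : ℤ) : ℝ)| ≤ (A + 1 : ℝ) / M := by
    rw [e, abs_div, abs_of_pos hM']
    gcongr
    linarith
  rw [circDist_eq_abs hx hy (h3.trans hA2)]
  refine ⟨?_, h3⟩
  rw [e, abs_div, abs_of_pos hM']
  gcongr
  linarith

/-- If in every long window few cells of width `1 / M` are empty, the graph is connected. -/
theorem connected_of_sparse {n M m : ℕ} {r₁ r₂ : ℝ} {X : Fin n → ℝ} {A B : ℤ} (hn : 0 < n)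
    (hX : ∀ i, X i ∈ Set.Icc (0 : ℝ) 1) (hM : 0 < M) (hB : 1 ≤ B) (hBA : B < A) (hm : 1 ≤ m)
    (hmA : m ≤ A) (hmW : m ≤ 2 * (A - B + 1)) (hr₁ : r₁ ≤ (B - 1 : ℝ) / M)
    (hr₂ : (A + 1 : ℝ) / M ≤ r₂) (hA2 : (A + 1 : ℝ) / M ≤ 1 / 2)
    (sparse : ∀ j, ∀ T ⊆ Finset.Ico j (j + 10 * A * m),
      (∀ t ∈ T, ∀ i, ¬ (M : ℤ) ∣ ⌊M * X i⌋ - t) → T.card < m) :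
    (graph n r₁ r₂ X).Connected := by
  have : Nonempty (Fin n) := ⟨⟨0, hn⟩⟩
  have hB' : (1 : ℝ) ≤ B := by exact_mod_cast hB
  have adj : ∀ i j p q, (M : ℤ) ∣ ⌊M * X i⌋ - p → (M : ℤ) ∣ ⌊M * X j⌋ - q → B ≤ |p - q| →
      |p - q| ≤ A → (graph n r₁ r₂ X).Reachable i j := by
    intro i j p q hp hq h1 h2
    obtain ⟨h3, h4⟩ := circDist_bounds_of_cells (hX i) (hX j) hM hp hq h1 h2 hA2
    refine SimpleGraph.Adj.reachable ⟨?_, hr₁.trans h3.le, h4.trans hr₂⟩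
    rintro rfl
    have : (0 : ℝ) ≤ (B - 1 : ℝ) / M := div_nonneg (by linarith) (by positivity)
    have h5 : circDist (X i) (X i) = 0 := by simp [circDist]
    linarith
  -- Empty cells get an arbitrary representative, so that reachability pulls back to an equivalence
  -- relation on all of `ℤ`.
  obtain ⟨rep, hrep⟩ : ∃ rep : ℤ → Fin n, ∀ p, (∃ i, (M : ℤ) ∣ ⌊M * X i⌋ - p) →
      (M : ℤ) ∣ ⌊M * X (rep p)⌋ - p := by
    refine ⟨fun p => Classical.epsilon fun i => (M : ℤ) ∣ ⌊M * X i⌋ - p, fun p hp => ?_⟩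
    exact Classical.epsilon_spec hp
  obtain ⟨c, hc⟩ := exists_hub (occ := fun p => ∃ i, (M : ℤ) ∣ ⌊M * X i⌋ - p)
    (r := fun p q => (graph n r₁ r₂ X).Reachable (rep p) (rep q))
    ⟨fun _ => SimpleGraph.Reachable.refl _, fun h => h.symm, fun h h' => h.trans h'⟩ hB hBA
    (fun p q hp hq h1 h2 => adj _ _ p q (hrep p hp) (hrep q hq) h1 h2) hm hmA hmW
    (fun j T hT h => sparse j T hT fun t ht i hi => h t ht ⟨i, hi⟩)
  -- Vertices sharing a cell need not be adjacent, so each vertex reaches the hub through a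
  -- neighbouring cell `q` and not through the representative of its own cell.
  have key : ∀ i, (graph n r₁ r₂ X).Reachable i (rep c) := by
    intro i
    obtain ⟨q, h1, h2, h3, h4⟩ := hc ⌊M * X i⌋
    exact (adj i (rep q) _ q (by simp) (hrep q h1) h2 h3).trans h4
  exact ⟨fun i j => (key i).trans (key j).symm⟩

/-! ### Union bound over empty cells -/

theorem measureReal_unif_Ico {u v : ℝ} (hu : 0 ≤ u) (huv : u ≤ v) (hv : v ≤ 1) :
    unif.real (Set.Ico u v) = v - u := by
  rw [measureReal_def, unif, Measure.restrict_apply measurableSet_Ico, Set.inter_eq_left.2,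
    Real.volume_Ico, ENNReal.toReal_ofReal (by linarith)]
  intro x hx
  exact ⟨hu.trans hx.1, hx.2.le.trans hv⟩

theorem ae_mem_Icc (n : ℕ) : ∀ᵐ X ∂positionLaw n, ∀ i, X i ∈ Set.Icc (0 : ℝ) 1 := by
  rw [ae_all_iff]
  intro i
  have h : ∀ᵐ x ∂unif, x ∈ Set.Icc (0 : ℝ) 1 := ae_restrict_mem measurableSet_Icc
  exact (Measure.tendsto_eval_ae_ae (μ := fun _ : Fin n => unif) (i := i)).eventually h

/-- The uniform measure of the complement of a set of cells, given by distinct residues. -/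
theorem measureReal_avoid_cells {M : ℕ} (hM : 0 < M) {T : Finset ℤ}
    (inj : ∀ s ∈ T, ∀ t ∈ T, (M : ℤ) ∣ s - t → s = t) :
    unif.real {x | ∀ t ∈ T, ¬ (M : ℤ) ∣ ⌊M * x⌋ - t} ≤ 1 - T.card / M := by
  have hM' : (0 : ℝ) < M := by exact_mod_cast hM
  have hMz : (0 : ℤ) < M := by exact_mod_cast hM
  let C : ℤ → Set ℝ := fun t => Set.Ico (((t % M : ℤ) : ℝ) / M) (((t % M : ℤ) + 1 : ℝ) / M)
  have hfloor : ∀ t, ∀ x ∈ C t, ⌊M * x⌋ = t % M := by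
    intro t x hx
    rw [Int.floor_eq_iff]
    obtain ⟨h1, h2⟩ := hx
    rw [div_le_iff₀ hM'] at h1
    rw [lt_div_iff₀ hM'] at h2
    constructor <;> linarith
  have hdvd : ∀ t : ℤ, (M : ℤ) ∣ t % M - t := fun t => by
    rw [← dvd_neg, neg_sub]
    exact Int.dvd_self_sub_emod
  have hC : unif.real (⋃ t ∈ T, C t) = T.card / M := by
    rw [measureReal_biUnion_finset]
    · have : ∀ t ∈ T, unif.real (C t) = 1 / M := by
        intro t _
        have h1 : (0 : ℝ) ≤ (t % M : ℤ) := by exact_mod_cast Int.emod_nonneg t hMz.ne'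
        have h2 : ((t % M : ℤ) : ℝ) + 1 ≤ M := by exact_mod_cast Int.emod_lt_of_pos t hMz
        rw [measureReal_unif_Ico (by positivity) (by gcongr; linarith)
          (by rw [div_le_one hM']; exact h2)]
        ring
      rw [Finset.sum_congr rfl this, Finset.sum_const, nsmul_eq_mul]
      ring
    · intro s hs t ht hst
      rw [Function.onFun, Set.disjoint_left]
      intro x hxs hxt
      refine hst (inj s hs t ht ?_)
      have h1 := dvd_sub (hdvd t) (hdvd s)
      rw [← hfloor s x hxs, ← hfloor t x hxt] at h1
      simpa using h1
    · intro t _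
      exact measurableSet_Ico
  have hmeas : MeasurableSet (⋃ t ∈ T, C t) :=
    Finset.measurableSet_biUnion _ fun t _ => measurableSet_Ico
  have hsub : {x : ℝ | ∀ t ∈ T, ¬ (M : ℤ) ∣ ⌊M * x⌋ - t} ⊆ (⋃ t ∈ T, C t)ᶜ := by
    intro x hx hx'
    simp only [Set.mem_iUnion] at hx'
    obtain ⟨t, ht, hxt⟩ := hx'
    refine hx t ht ?_
    rw [hfloor t x hxt]
    exact hdvd t
  calc _ ≤ unif.real (⋃ t ∈ T, C t)ᶜ := measureReal_mono hsub
    _ = 1 - T.card / M := by rw [probReal_compl_eq_one_sub hmeas, hC]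

theorem positionLaw_forall (n : ℕ) (F : Set ℝ) :
    positionLaw n {X | ∀ i, X i ∈ F} = unif F ^ n := by
  have : {X : Fin n → ℝ | ∀ i, X i ∈ F} = Set.univ.pi fun _ => F := by
    ext X
    simp
  rw [this, positionLaw, Measure.pi_pi]
  simp

/-- A lower bound for the probability of connectedness from a union bound over empty cells. -/
theorem one_le_prob_connected_add {n M m : ℕ} {r₁ r₂ : ℝ} {A B : ℤ} (hn : 0 < n)
    (hM : 0 < M) (hB : 1 ≤ B) (hBA : B < A) (hm : 1 ≤ m)
    (hmA : m ≤ A) (hmW : m ≤ 2 * (A - B + 1)) (hr₁ : r₁ ≤ (B - 1 : ℝ) / M)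
    (hr₂ : (A + 1 : ℝ) / M ≤ r₂) (hA2 : (A + 1 : ℝ) / M ≤ 1 / 2) (hKM : 10 * A * m ≤ M) :
    1 ≤ prob n r₁ r₂ (fun G => G.Connected) +
      ENNReal.ofReal (M * ((10 * A * m).toNat.choose m * Real.exp (-(m * n / M)))) := by
  have hM' : (0 : ℝ) < M := by exact_mod_cast hM
  have hMz : (0 : ℤ) < M := by exact_mod_cast hM
  let F : ℤ → Finset ℤ → Set ℝ := fun j T => {x | ∀ t ∈ T.image (j + ·), ¬ (M : ℤ) ∣ ⌊M * x⌋ - t}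
  let I := Finset.Ico (0 : ℤ) M ×ˢ (Finset.Ico (0 : ℤ) (10 * A * m)).powersetCard m
  let bad : Set (Fin n → ℝ) := ⋃ z ∈ I, {X | ∀ i, X i ∈ F z.1 z.2}
  have hF : ∀ z ∈ I, positionLaw n {X | ∀ i, X i ∈ F z.1 z.2} ≤
      ENNReal.ofReal (Real.exp (-(m * n / M))) := by
    intro z hz
    obtain ⟨-, hz2⟩ := Finset.mem_product.1 hz
    obtain ⟨hz3, hz4⟩ := Finset.mem_powersetCard.1 hz2
    have h1 := measureReal_avoid_cells hM (T := z.2.image (z.1 + ·)) (by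
      intro s hs t ht hst
      obtain ⟨s', hs', rfl⟩ := Finset.mem_image.1 hs
      obtain ⟨t', ht', rfl⟩ := Finset.mem_image.1 ht
      have h1 := Finset.mem_Ico.1 (hz3 hs')
      have h2 := Finset.mem_Ico.1 (hz3 ht')
      exact eq_of_dvd_sub_of_mem_Icc (u := z.1 - 1) (by omega) (by omega) hst)
    rw [Finset.card_image_of_injective _ (add_right_injective z.1), hz4] at h1
    rw [positionLaw_forall, ← ofReal_measureReal, ← ENNReal.ofReal_pow measureReal_nonneg]
    refine ENNReal.ofReal_le_ofReal ?_
    calc unif.real (F z.1 z.2) ^ n ≤ Real.exp (-(m / M)) ^ n := by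
          refine pow_le_pow_left₀ measureReal_nonneg (h1.trans ?_) n
          exact Real.one_sub_le_exp_neg _
      _ = Real.exp (-(m * n / M)) := by
          rw [← Real.exp_nat_mul]
          congr 1
          ring
  have hbad : positionLaw n bad ≤
      ENNReal.ofReal (M * ((10 * A * m).toNat.choose m * Real.exp (-(m * n / M)))) := by
    refine (measure_biUnion_finset_le I _).trans ((Finset.sum_le_sum hF).trans ?_)
    rw [Finset.sum_const, Finset.card_product, Finset.card_powersetCard, Int.card_Ico,
      Int.card_Ico, nsmul_eq_mul, ENNReal.ofReal_mul (by positivity),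
      ENNReal.ofReal_mul (by positivity)]
    simp [mul_assoc]
  have hcover : ∀ᵐ X ∂positionLaw n, X ∈ {X | (graph n r₁ r₂ X).Connected} ∪ bad := by
    filter_upwards [ae_mem_Icc n] with X hX
    by_cases hXb : X ∈ bad
    · exact Or.inr hXb
    refine Or.inl (connected_of_sparse hn hX hM hB hBA hm hmA hmW hr₁ hr₂ hA2 ?_)
    intro j T hT hT'
    by_contra! hcard
    obtain ⟨U, hUT, hU⟩ := Finset.exists_subset_card_eq hcard
    refine hXb ?_
    simp only [bad, Set.mem_iUnion]
    -- Occupancy is periodic modulo `M`, so `M` window positions suffice.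
    refine ⟨(j % M, U.image (· - j)), ?_, ?_⟩
    · refine Finset.mem_product.2 ⟨?_, Finset.mem_powersetCard.2 ⟨?_, ?_⟩⟩
      · exact Finset.mem_Ico.2 ⟨Int.emod_nonneg _ hMz.ne', Int.emod_lt_of_pos _ hMz⟩
      · intro y hy
        obtain ⟨e, he, rfl⟩ := Finset.mem_image.1 hy
        have := Finset.mem_Ico.1 (hT (hUT he))
        exact Finset.mem_Ico.2 ⟨by omega, by omega⟩
      · rw [Finset.card_image_of_injective _ (sub_left_injective), hU]
    · intro i t ht hdvd
      obtain ⟨y, hy, rfl⟩ := Finset.mem_image.1 ht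
      obtain ⟨e, he, rfl⟩ := Finset.mem_image.1 hy
      refine hT' e (hUT he) i ?_
      have h1 : (M : ℤ) ∣ j - j % M := Int.dvd_self_sub_emod
      have h2 : ⌊M * X i⌋ - e = ⌊M * X i⌋ - (j % M + (e - j)) - (j - j % M) := by ring
      rw [h2]
      exact dvd_sub hdvd h1
  calc (1 : ENNReal) = positionLaw n ({X | (graph n r₁ r₂ X).Connected} ∪ bad) := by
        rw [← measure_univ (μ := positionLaw n)]
        exact (measure_congr (eventuallyEq_univ.2 hcover)).symm
    _ ≤ _ := (measure_union_le _ _).trans (add_le_add le_rfl hbad)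

theorem tendsto_log_div_nat : Tendsto (fun n : ℕ => Real.log n / n) atTop (𝓝 0) :=
  (Real.isLittleO_log_id_atTop.tendsto_div_nhds_zero).comp tendsto_natCast_atTop_atTop

theorem tendsto_log_nat : Tendsto (fun n : ℕ => Real.log n) atTop atTop :=
  Real.tendsto_log_atTop.comp tendsto_natCast_atTop_atTop

set_option maxHeartbeats 400000 in
theorem tendsto_prob_connected {a b : ℝ} (hb : 0 ≤ b) (ha : 1 < a) (hab : 1 / 2 < a - b) :
    Tendsto (fun n : ℕ => prob n (b * Real.log n / n) (a * Real.log n / n)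
      (fun G => G.Connected)) atTop (𝓝 1) := by
  -- After rounding, `A > a * N - 2` and `2 * (A - B + 1) > 2 * (a - b) * N - 8`; the `3` and the
  -- `9` make both exceed `N + 1`.
  obtain ⟨N, hN⟩ : ∃ N : ℕ, 3 / (a - 1) + 9 / (2 * (a - b) - 1) + 3 ≤ N := exists_nat_ge _
  have h3 : 0 < 3 / (a - 1) := div_pos (by norm_num) (by linarith)
  have h9 : 0 < 9 / (2 * (a - b) - 1) := div_pos (by norm_num) (by linarith)
  have hN3 : (3 : ℝ) ≤ N := by linarith
  have hN1 : 3 ≤ (a - 1) * N := by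
    rw [← div_le_iff₀' (by linarith)]; linarith
  have hN2 : 9 ≤ (2 * (a - b) - 1) * N := by
    rw [← div_le_iff₀' (by linarith)]; linarith
  obtain ⟨A, hA⟩ : ∃ A : ℤ, A = ⌊a * N⌋ - 1 := ⟨_, rfl⟩
  -- Positions inside cells shift distances by less than one cell width, hence the margin of one in
  -- `A` and in `B`; the second unit in `B` absorbs the rounding up of `M`.
  obtain ⟨B, hB⟩ : ∃ B : ℤ, B = ⌈b * N⌉ + 2 := ⟨_, rfl⟩
  have hA1 : (A : ℝ) + 1 ≤ a * N := by
    rw [hA]; push_cast; linarith [Int.floor_le (a * N)]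
  have hA2 : a * N - 2 < A := by
    rw [hA]; push_cast; linarith [Int.lt_floor_add_one (a * N)]
  have hB1 : b * N + 1 ≤ B - 1 := by
    rw [hB]; push_cast; linarith [Int.le_ceil (b * N)]
  have hB2 : (B : ℝ) < b * N + 3 := by
    rw [hB]; push_cast; linarith [Int.ceil_lt_add_one (b * N)]
  have hbN : 0 ≤ b * N := by positivity
  have cB : 1 ≤ B := by
    have : (1 : ℝ) ≤ B := by linarith
    exact_mod_cast this
  have cA : ((N + 1 : ℕ) : ℤ) ≤ A := by
    have : ((N + 1 : ℕ) : ℝ) ≤ A := by push_cast; linarith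
    exact_mod_cast this
  have cW : ((N + 1 : ℕ) : ℤ) ≤ 2 * (A - B + 1) := by
    have : ((N + 1 : ℕ) : ℝ) ≤ 2 * (A - B + 1) := by push_cast; linarith
    exact_mod_cast this
  have cBA : B < A := by
    have : 3 ≤ N := by exact_mod_cast hN3
    omega
  obtain ⟨K, hK⟩ : ∃ K : ℝ, K = (10 * A * (N + 1 : ℕ)).toNat.choose (N + 1) := ⟨_, rfl⟩
  have hK0 : 0 ≤ K := by rw [hK]; positivity
  have herr : Tendsto (fun n : ℕ => ENNReal.ofReal (K * Real.exp (-(Real.log n / (2 * N)))))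
      atTop (𝓝 0) := by
    rw [← ENNReal.ofReal_zero]
    refine ENNReal.tendsto_ofReal ?_
    rw [← mul_zero K]
    refine Tendsto.const_mul K (Real.tendsto_exp_neg_atTop_nhds_zero.comp ?_)
    exact tendsto_log_nat.atTop_div_const (by linarith)
  have hlow : ∀ᶠ n : ℕ in atTop,
      1 - ENNReal.ofReal (K * Real.exp (-(Real.log n / (2 * N)))) ≤
        prob n (b * Real.log n / n) (a * Real.log n / n) (fun G => G.Connected) := by
    have hsmall : ∀ δ : ℝ, 0 < δ → ∀ᶠ n : ℕ in atTop, Real.log n / n < δ := fun δ hδ =>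
      tendsto_log_div_nat.eventually_lt_const hδ
    filter_upwards [eventually_ge_atTop 2, tendsto_log_nat.eventually_ge_atTop (2 * N),
      hsmall (1 / 4) (by norm_num), hsmall (1 / (2 * a)) (by positivity),
      hsmall (1 / (b + 1)) (by positivity),
      hsmall (1 / (10 * A * (N + 1) + 1)) (by
        have : (0 : ℝ) < A := by linarith
        positivity)] with n hn hL h4 ha2 hb1 hKM
    have hn' : (2 : ℝ) ≤ n := by exact_mod_cast hn
    have hn0 : (0 : ℝ) < n := by linarith
    generalize hLdef : Real.log n = L at *
    have hL0 : 0 < L := by linarith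
    rw [div_lt_iff₀ hn0] at h4
    obtain ⟨M, hMdef⟩ : ∃ M : ℕ, M = ⌈N * n / L⌉₊ := ⟨_, rfl⟩
    have hM1 : N * n ≤ M * L := by
      rw [← div_le_iff₀ hL0, hMdef]; exact Nat.le_ceil _
    have hM2 : M * L < N * n + L := by
      have h1 : (M : ℝ) < N * n / L + 1 := by
        rw [hMdef]; exact Nat.ceil_lt_add_one (by positivity)
      calc M * L < (N * n / L + 1) * L := by gcongr
        _ = N * n + L := by field_simp
    have hM0 : (0 : ℝ) < M := by
      by_contra! h
      nlinarith [mul_pos (by linarith : (0 : ℝ) < N) hn0]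
    have hMn : (M : ℝ) ≤ n := by
      refine le_of_mul_le_mul_right ?_ hL0
      nlinarith
    have main := one_le_prob_connected_add (n := n) (M := M) (m := N + 1)
      (r₁ := b * L / n) (r₂ := a * L / n) (A := A) (B := B) (by omega) (by exact_mod_cast hM0)
      cB cBA (by omega) cA cW ?_ ?_ ?_ ?_
    · refine tsub_le_iff_right.2 (main.trans (add_le_add le_rfl (ENNReal.ofReal_le_ofReal ?_)))
      rw [← hK]
      have e1 : (n : ℝ) = Real.exp L := by rw [← hLdef, Real.exp_log hn0]
      -- Without rounding the right side would be `L + L / N`; half of the excess pays for the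
      -- rounding of `M`.
      have e2 : L + L / (2 * N) ≤ (N + 1 : ℕ) * n / M := by
        have h5 : L / (2 * N) ≤ L / 2 := by gcongr; linarith
        have h6 : M * L / (2 * N) ≤ (N * n + L) / (2 * N) := by gcongr
        have h7 : (N * n + L) / (2 * N) = n / 2 + L / (2 * N) := by field_simp
        have h8 : L / (2 * N) * M = M * L / (2 * N) := by ring
        rw [le_div_iff₀ hM0, add_mul, h8]
        push_cast
        linarith
      calc (M : ℝ) * (K * Real.exp (-((N + 1 : ℕ) * n / M)))
          ≤ n * (K * Real.exp (-(L + L / (2 * N)))) := by gcongr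
        _ = K * (Real.exp L * Real.exp (-(L + L / (2 * N)))) := by rw [← e1]; ring
        _ = K * Real.exp (-(L / (2 * N))) := by
          rw [← Real.exp_add]
          congr 2
          ring
    · rw [div_lt_div_iff₀ hn0 (by linarith), one_mul] at hb1
      rw [div_le_div_iff₀ hn0 hM0]
      linarith [mul_le_mul_of_nonneg_left hM2.le hb, mul_le_mul_of_nonneg_right hB1 hn0.le]
    · rw [div_le_div_iff₀ hM0 hn0]
      linarith [mul_le_mul_of_nonneg_right hA1 hn0.le,
        mul_le_mul_of_nonneg_right hM1 (by linarith : 0 ≤ a)]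
    · rw [div_lt_div_iff₀ hn0 (by linarith), one_mul] at ha2
      rw [div_le_div_iff₀ hM0 (by norm_num)]
      have h5 : ((A : ℝ) + 1) * 2 * n ≤ 1 * M * n := by
        linarith [mul_le_mul_of_nonneg_right hA1 hn0.le, mul_le_mul_of_nonneg_right hM1
          (by linarith : 0 ≤ 2 * a), mul_le_mul_of_nonneg_left ha2.le hM0.le]
      exact le_of_mul_le_mul_right h5 hn0
    · have hA0 : (0 : ℝ) < A := by linarith
      rw [div_lt_div_iff₀ hn0 (by positivity), one_mul] at hKM
      have h5 : (10 * A * (N + 1 : ℕ) : ℝ) ≤ M := by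
        refine le_of_mul_le_mul_right ?_ hL0
        have h6 : 1 * (n : ℝ) ≤ N * n := by gcongr; linarith
        push_cast
        linarith
      exact_mod_cast h5
  refine tendsto_of_tendsto_of_tendsto_of_le_of_le' ?_ tendsto_const_nhds hlow
    (Eventually.of_forall fun n => prob_le_one)
  have := ENNReal.Tendsto.sub (tendsto_const_nhds (x := (1 : ENNReal))) herr (by simp)
  simpa using this

end Sufficient

/-! ### Second moment method for occupied cells next to empty regions -/

section Necessary

/-- Chebyshev's inequality for the number of events that occur, given equal probabilities and a
common bound for the probabilities of the pairwise intersections. -/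
theorem measureReal_at_most_one_le {Ω : Type*} [MeasurableSpace Ω] (P : Measure Ω)
    [IsProbabilityMeasure P] {Q : ℕ} {G : Fin Q → Set Ω} (hG : ∀ k, MeasurableSet (G k))
    {p q : ℝ} (hp : ∀ k, P.real (G k) = p) (hq0 : 0 ≤ q)
    (hq : ∀ k l, k ≠ l → P.real (G k ∩ G l) ≤ q) (hQp : 1 < Q * p) :
    P.real {ω | ∀ k l, ω ∈ G k → ω ∈ G l → k = l} ≤
      (Q * p + Q ^ 2 * q - (Q * p) ^ 2) / (Q * p - 1) ^ 2 := by
  let N : Ω → ℝ := fun ω => ∑ k, (G k).indicator 1 ω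
  have hind : ∀ s : Set Ω, MeasurableSet s → Integrable (s.indicator (1 : Ω → ℝ)) P :=
    fun s hs => (integrable_const (1 : ℝ)).indicator hs
  have hNi : Integrable N P := integrable_finsetSum _ fun k _ => hind _ (hG k)
  have hN : ∫ ω, N ω ∂P = Q * p := by
    rw [integral_finsetSum _ fun k _ => hind _ (hG k)]
    simp [integral_indicator_one, hG, hp]
  have hsq : ∀ ω, N ω ^ 2 = ∑ k, ∑ l, (G k ∩ G l).indicator 1 ω := by
    intro ω
    rw [sq, Finset.sum_mul_sum]
    refine Finset.sum_congr rfl fun k _ => Finset.sum_congr rfl fun l _ => ?_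
    rw [Set.inter_indicator_one]
    rfl
  have hN2i : Integrable (fun ω => N ω ^ 2) P := by
    simp_rw [hsq]
    exact integrable_finsetSum _ fun k _ => integrable_finsetSum _ fun l _ =>
      hind _ ((hG k).inter (hG l))
  have hN2 : ∫ ω, N ω ^ 2 ∂P ≤ Q * p + Q ^ 2 * q := by
    simp_rw [hsq]
    rw [integral_finsetSum _ fun k _ => integrable_finsetSum _ fun l _ =>
      hind _ ((hG k).inter (hG l))]
    have hk : ∀ k, ∫ ω, ∑ l, (G k ∩ G l).indicator (1 : Ω → ℝ) ω ∂P ≤ p + Q * q := by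
      intro k
      rw [integral_finsetSum _ fun l _ => hind _ ((hG k).inter (hG l))]
      calc ∑ l, ∫ ω, (G k ∩ G l).indicator (1 : Ω → ℝ) ω ∂P
          ≤ ∑ l, ((if k = l then p else 0) + q) := by
            refine Finset.sum_le_sum fun l _ => ?_
            rw [integral_indicator_one ((hG k).inter (hG l))]
            split_ifs with h
            · subst h
              rw [Set.inter_self, hp]
              linarith
            · linarith [hq k l h]
        _ = p + Q * q := by
            rw [Finset.sum_add_distrib]
            simp
    calc _ ≤ ∑ _k : Fin Q, (p + Q * q) := Finset.sum_le_sum fun k _ => hk k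
      _ = Q * p + Q ^ 2 * q := by
        rw [Finset.sum_const, Finset.card_univ, Fintype.card_fin, nsmul_eq_mul]
        ring
  have hexp : ∀ ω, (N ω - Q * p) ^ 2 = N ω ^ 2 - 2 * (Q * p) * N ω + (Q * p) ^ 2 :=
    fun ω => by ring
  have hvi : Integrable (fun ω => (N ω - Q * p) ^ 2) P := by
    simp_rw [hexp]
    exact (hN2i.sub (hNi.const_mul _)).add (integrable_const _)
  have hvar : ∫ ω, (N ω - Q * p) ^ 2 ∂P ≤ Q * p + Q ^ 2 * q - (Q * p) ^ 2 := by
    simp_rw [hexp]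
    rw [integral_add (f := fun ω => N ω ^ 2 - 2 * (Q * p) * N ω) (g := fun _ => (Q * p) ^ 2)
      (hN2i.sub (hNi.const_mul _)) (integrable_const _),
      integral_sub (f := fun ω => N ω ^ 2) (g := fun ω => 2 * (Q * p) * N ω)
      hN2i (hNi.const_mul _), integral_const_mul, hN]
    simp only [integral_const, probReal_univ, smul_eq_mul, one_mul]
    linarith
  rw [le_div_iff₀' (by nlinarith)]
  refine le_trans ?_ hvar
  refine le_trans ?_ (mul_meas_ge_le_integral_of_nonneg
    (ae_of_all _ fun ω => sq_nonneg (N ω - Q * p)) hvi ((Q * p - 1) ^ 2))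
  -- If at most one event occurs, the count is at most `1` and falls short of its mean by at least
  -- `Q * p - 1 > 0`.
  refine mul_le_mul_of_nonneg_left (measureReal_mono ?_) (sq_nonneg _)
  intro ω hω
  have hN1 : N ω ≤ 1 := by
    by_cases h : ∃ k, ω ∈ G k
    · obtain ⟨k, hk⟩ := h
      refine (Finset.sum_eq_single_of_mem k (Finset.mem_univ k) ?_).trans_le ?_
      · intro l _ hl
        exact Set.indicator_of_notMem (fun hl' => hl (hω l k hl' hk)) _
      · simp [hk]
    · push Not at h
      refine (Finset.sum_eq_zero fun k _ => Set.indicator_of_notMem (h k) _).trans_le ?_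
      norm_num
  change (Q * p - 1) ^ 2 ≤ (N ω - Q * p) ^ 2
  nlinarith

theorem measurableSet_forall_mem {n : ℕ} {F : Set ℝ} (hF : MeasurableSet F) :
    MeasurableSet {X : Fin n → ℝ | ∀ i, X i ∈ F} := by
  rw [Set.ofPred_forall]
  exact MeasurableSet.iInter fun i => measurable_pi_apply i hF

theorem positionLaw_real_forall (n : ℕ) (F : Set ℝ) :
    (positionLaw n).real {X | ∀ i, X i ∈ F} = unif.real F ^ n := by
  rw [measureReal_def, positionLaw_forall, ENNReal.toReal_pow, measureReal_def]

/-- The configurations in which the cell `C` contains a point and the region `S` does not. -/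
def occupiedNextTo (n : ℕ) (C S : Set ℝ) : Set (Fin n → ℝ) :=
  {X | (∃ i, X i ∈ C) ∧ ∀ i, X i ∉ S}

theorem occupiedNextTo_eq (n : ℕ) (C S : Set ℝ) :
    occupiedNextTo n C S = {X | ∀ i, X i ∈ Sᶜ} \ {X | ∀ i, X i ∈ (S ∪ C)ᶜ} := by
  ext X
  simp only [occupiedNextTo, Set.mem_ofPred_eq, Set.mem_sdiff, Set.mem_compl_iff, Set.mem_union,
    not_forall, not_or, not_and, not_not]
  constructor
  · rintro ⟨⟨i, hi⟩, h⟩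
    exact ⟨h, i, fun _ => hi⟩
  · rintro ⟨h, i, hi⟩
    exact ⟨⟨i, hi (h i)⟩, h⟩

theorem measureReal_occupiedNextTo (n : ℕ) {C S : Set ℝ} (hC : MeasurableSet C)
    (hS : MeasurableSet S) (hCS : Disjoint S C) :
    (positionLaw n).real (occupiedNextTo n C S) =
      (1 - unif.real S) ^ n - (1 - unif.real S - unif.real C) ^ n := by
  rw [occupiedNextTo_eq, measureReal_sdiff ?_ (measurableSet_forall_mem (hS.union hC).compl),
    positionLaw_real_forall, positionLaw_real_forall, probReal_compl_eq_one_sub hS,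
    probReal_compl_eq_one_sub (hS.union hC), measureReal_union hCS hC, sub_add_eq_sub_sub]
  intro X hX i hi
  exact hX i (Or.inl hi)

/-- For the joint probabilities only the emptiness of two disjoint regions is kept; dropping the
occupancy of the cells costs a factor that tends to `1`. -/
theorem measureReal_at_most_one_occupied_le {n Q : ℕ} {C S : Fin Q → Set ℝ} {s h : ℝ}
    (hC : ∀ k, MeasurableSet (C k)) (hS : ∀ k, MeasurableSet (S k))
    (hCm : ∀ k, unif.real (C k) = h) (hSm : ∀ k, unif.real (S k) = s) (hs : 2 * s ≤ 1)
    (hCS : ∀ k, Disjoint (S k) (C k)) (hSS : ∀ k l, k ≠ l → Disjoint (S k) (S l))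
    (hQ : 1 < Q * ((1 - s) ^ n - (1 - s - h) ^ n)) :
    (positionLaw n).real {X | ∀ k l, X ∈ occupiedNextTo n (C k) (S k) →
        X ∈ occupiedNextTo n (C l) (S l) → k = l} ≤
      (Q * ((1 - s) ^ n - (1 - s - h) ^ n) + Q ^ 2 * (1 - 2 * s) ^ n -
        (Q * ((1 - s) ^ n - (1 - s - h) ^ n)) ^ 2) /
        (Q * ((1 - s) ^ n - (1 - s - h) ^ n) - 1) ^ 2 := by
  refine measureReal_at_most_one_le (positionLaw n) (fun k => ?_) (fun k => ?_)
    (pow_nonneg (by linarith) n) (fun k l hkl => ?_) hQ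
  · rw [occupiedNextTo_eq]
    exact (measurableSet_forall_mem (hS k).compl).diff
      (measurableSet_forall_mem ((hS k).union (hC k)).compl)
  · rw [measureReal_occupiedNextTo n (hC k) (hS k) (hCS k), hCm, hSm]
  · calc _ ≤ (positionLaw n).real {X | ∀ i, X i ∈ (S k ∪ S l)ᶜ} := by
          refine measureReal_mono ?_
          rintro X ⟨⟨-, h1⟩, -, h2⟩ i hi
          exact hi.elim (h1 i) (h2 i)
      _ = (1 - 2 * s) ^ n := by
          rw [positionLaw_real_forall, probReal_compl_eq_one_sub ((hS k).union (hS l)),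
            measureReal_union (hSS k l hkl) (hS l), hSm, hSm, two_mul]

/-- Growth of the expected number of occupied cells next to an empty region. -/
theorem eventually_le_expected_count {c ε D : ℝ} (hc0 : 0 ≤ c) (hc : c < 1) (hε : 0 < ε)
    (hD : 0 < D) : ∀ᶠ n : ℕ in atTop,
      ((1 - c) / 2) ^ 2 * Real.log n / (8 * D) ≤ ⌊n / (D * Real.log n)⌋₊ *
        ((1 - c * Real.log n / n) ^ n - (1 - c * Real.log n / n - ε * Real.log n / n) ^ n) ∧
      (1 - 2 * (c * Real.log n / n)) ^ n * (1 - Real.exp (-(ε * Real.log n))) ^ 2 ≤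
        ((1 - c * Real.log n / n) ^ n - (1 - c * Real.log n / n - ε * Real.log n / n) ^ n) ^ 2 ∧
      2 * (c * Real.log n / n) ≤ 1 := by
  have hsmall : ∀ δ : ℝ, 0 < δ → ∀ᶠ n : ℕ in atTop, Real.log n / n < δ := fun δ hδ =>
    tendsto_log_div_nat.eventually_lt_const hδ
  filter_upwards [eventually_ge_atTop 1, tendsto_log_nat.eventually_ge_atTop 1,
    tendsto_log_nat.eventually_ge_atTop (1 / ε), hsmall ((1 - c) / 2) (by linarith),
    hsmall (1 / (c + ε)) (by positivity), hsmall (1 / (2 * D)) (by positivity)]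
    with n hn hL hLε hx hx2 hxD
  have hn0 : (0 : ℝ) < n := by exact_mod_cast hn
  have hexpL : Real.exp (Real.log n) = n := Real.exp_log hn0
  generalize Real.log n = L at *
  rw [mul_div_assoc c, mul_div_assoc ε]
  generalize hxdef : L / n = x at *
  have hxL : L = n * x := by rw [← hxdef]; field_simp
  have hL0 : 0 < L := by linarith
  have hx0 : 0 < x := by rw [← hxdef]; positivity
  have hcx : c * x + ε * x ≤ 1 := by
    rw [lt_div_iff₀ (by positivity)] at hx2
    linarith
  have hεx : 0 < ε * x := by positivity
  have hcx0 : 0 ≤ c * x := by positivity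
  have h1c : 0 ≤ 1 - c * x := by linarith
  have h2c : 2 * (c * x) ≤ 1 := by
    nlinarith [mul_le_mul_of_nonneg_left hx.le hc0, sq_nonneg (c - 1 / 2)]
  have hd : (1 - ε * x) ^ n ≤ Real.exp (-(ε * L)) := by
    calc (1 - ε * x) ^ n ≤ Real.exp (-(ε * x)) ^ n :=
          pow_le_pow_left₀ (by linarith) (Real.one_sub_le_exp_neg _) n
      _ = Real.exp (-(ε * L)) := by rw [← Real.exp_nat_mul, hxL]; congr 1; ring
  have hp : (1 - c * x) ^ n * (1 - Real.exp (-(ε * L))) ≤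
      (1 - c * x) ^ n - (1 - c * x - ε * x) ^ n := by
    have h1 : (1 - c * x - ε * x) ^ n ≤ (1 - c * x) ^ n * Real.exp (-(ε * L)) := by
      calc (1 - c * x - ε * x) ^ n ≤ ((1 - c * x) * (1 - ε * x)) ^ n :=
            pow_le_pow_left₀ (by linarith) (by nlinarith) n
        _ = (1 - c * x) ^ n * (1 - ε * x) ^ n := mul_pow _ _ _
        _ ≤ _ := by gcongr
    linarith
  have hdlt : Real.exp (-(ε * L)) ≤ 1 / 2 := by
    have h1 : 1 ≤ ε * L := by rwa [div_le_iff₀' hε] at hLε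
    have h2 : Real.exp (-(ε * L)) ≤ Real.exp (-1) := by gcongr
    linarith [Real.exp_neg_one_lt_half]
  refine ⟨?_, ?_, h2c⟩
  · have hQ : n / (2 * D * L) ≤ (⌊n / (D * L)⌋₊ : ℝ) := by
      have h1 := Nat.lt_floor_add_one (n / (D * L))
      have h2 : 1 ≤ n / (2 * D * L) := by
        rw [lt_div_iff₀ (by positivity)] at hxD
        rw [le_div_iff₀ (by positivity), hxL]
        nlinarith
      have h3 : n / (D * L) = 2 * (n / (2 * D * L)) := by field_simp
      linarith
    -- The exponent `(1 + c) / 2`, midway between `c` and `1`, leaves room for the second-order term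
    -- and still gives growth `n ^ ((1 - c) / 2)`.
    have hz : Real.exp (-((1 + c) / 2 * L)) ≤ (1 - c * x) ^ n := by
      have h1 : Real.exp (-((1 + c) / 2 * x)) ≤ 1 - c * x := by
        have h2 : (1 + c) / 2 * x + 1 ≤ Real.exp ((1 + c) / 2 * x) := Real.add_one_le_exp _
        rw [Real.exp_neg, inv_le_comm₀ (Real.exp_pos _) (by linarith)]
        refine le_trans ?_ h2
        rw [inv_le_iff_one_le_mul₀ (by linarith)]
        have h3 : c * ((1 + c) / 2) ≤ 1 := by nlinarith
        nlinarith [mul_le_mul_of_nonneg_right h3 (mul_self_nonneg x)]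
      calc Real.exp (-((1 + c) / 2 * L)) = Real.exp (-((1 + c) / 2 * x)) ^ n := by
            rw [← Real.exp_nat_mul, hxL]; congr 1; ring
        _ ≤ _ := pow_le_pow_left₀ (Real.exp_pos _).le h1 n
    have hgrow : ((1 - c) / 2) ^ 2 * L ^ 2 / 2 ≤ n * Real.exp (-((1 + c) / 2 * L)) := by
      have h1 := Real.quadratic_le_exp_of_nonneg (x := (1 - c) / 2 * L)
        (mul_nonneg (by linarith) hL0.le)
      have h2 : n * Real.exp (-((1 + c) / 2 * L)) = Real.exp ((1 - c) / 2 * L) := by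
        rw [← hexpL, ← Real.exp_add]; congr 1; ring
      have h3 : 0 ≤ (1 - c) / 2 * L := mul_nonneg (by linarith) hL0.le
      rw [h2]
      nlinarith
    calc ((1 - c) / 2) ^ 2 * L / (8 * D)
        = (((1 - c) / 2) ^ 2 * L ^ 2 / 2) * (1 / (4 * D * L)) := by field_simp; ring
      _ ≤ (n * Real.exp (-((1 + c) / 2 * L))) * (1 / (4 * D * L)) := by gcongr
      _ = n / (2 * D * L) * (Real.exp (-((1 + c) / 2 * L)) * (1 / 2)) := by
          field_simp; ring
      _ ≤ ⌊n / (D * L)⌋₊ * ((1 - c * x) ^ n * (1 - Real.exp (-(ε * L)))) := by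
          gcongr
          linarith
      _ ≤ _ := by gcongr
  · calc (1 - 2 * (c * x)) ^ n * (1 - Real.exp (-(ε * L))) ^ 2
        ≤ ((1 - c * x) ^ 2) ^ n * (1 - Real.exp (-(ε * L))) ^ 2 := by
          gcongr
          nlinarith [sq_nonneg (c * x)]
      _ = ((1 - c * x) ^ n * (1 - Real.exp (-(ε * L)))) ^ 2 := by
          rw [← pow_mul, mul_comm 2 n, pow_mul, mul_pow]
      _ ≤ _ := by
          refine pow_le_pow_left₀ (mul_nonneg (by positivity) (by linarith)) hp 2

/-- If two occupied cells, each next to an empty region, force the graph to be disconnected, where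
the regions have measure `c * log n / n` with `c < 1`, the graph is disconnected with high
probability. -/
theorem tendsto_prob_not_connected_of_slots {r₁ r₂ : ℕ → ℝ} {c ε D : ℝ} (hc0 : 0 ≤ c)
    (hc : c < 1) (hε : 0 < ε) (hD : 0 < D) {C S : (n : ℕ) → ℕ → Set ℝ}
    (hC : ∀ n k, MeasurableSet (C n k)) (hS : ∀ n k, MeasurableSet (S n k))
    (hslots : ∀ᶠ n : ℕ in atTop, ∀ k < ⌊n / (D * Real.log n)⌋₊,
      unif.real (C n k) = ε * Real.log n / n ∧ unif.real (S n k) = c * Real.log n / n ∧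
      Disjoint (S n k) (C n k) ∧
      S n k ⊆ Set.Ico (k * (D * Real.log n / n)) ((k + 1) * (D * Real.log n / n)))
    (hdisc : ∀ᶠ n : ℕ in atTop, ∀ k l, k < l → l < ⌊n / (D * Real.log n)⌋₊ → ∀ X : Fin n → ℝ,
      (∀ i, X i ∈ Set.Icc (0 : ℝ) 1) → X ∈ occupiedNextTo n (C n k) (S n k) →
      X ∈ occupiedNextTo n (C n l) (S n l) → ¬ (graph n (r₁ n) (r₂ n) X).Connected) :
    Tendsto (fun n : ℕ => prob n (r₁ n) (r₂ n) (fun G => ¬ G.Connected)) atTop (𝓝 1) := by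
  let δ : ℕ → ℝ := fun n => 4 / (((1 - c) / 2) ^ 2 * Real.log n / (8 * D)) +
    4 * (1 / (1 - Real.exp (-(ε * Real.log n))) ^ 2 - 1)
  have hgrow : Tendsto (fun n : ℕ => ((1 - c) / 2) ^ 2 * Real.log n / (8 * D)) atTop atTop :=
    (tendsto_log_nat.const_mul_atTop (pow_pos (by linarith) 2)).atTop_div_const (by positivity)
  have hd : Tendsto (fun n : ℕ => Real.exp (-(ε * Real.log n))) atTop (𝓝 0) :=
    Real.tendsto_exp_neg_atTop_nhds_zero.comp (tendsto_log_nat.const_mul_atTop hε)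
  have hδ : Tendsto δ atTop (𝓝 0) := by
    have h1 : Tendsto (fun n : ℕ => 1 / (1 - Real.exp (-(ε * Real.log n))) ^ 2) atTop
        (𝓝 (1 / (1 - 0) ^ 2)) :=
      tendsto_const_nhds.div ((tendsto_const_nhds.sub hd).pow 2) (by norm_num)
    have h2 := (hgrow.const_div_atTop 4).add ((h1.sub_const 1).const_mul 4)
    simpa [δ] using h2
  have hlow : ∀ᶠ n : ℕ in atTop,
      1 - ENNReal.ofReal (δ n) ≤ prob n (r₁ n) (r₂ n) (fun G => ¬ G.Connected) := by
    filter_upwards [eventually_le_expected_count hc0 hc hε hD, hslots, hdisc,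
      hgrow.eventually_ge_atTop 2, hd.eventually_le_const (by norm_num : (0 : ℝ) < 1 / 2),
      tendsto_log_nat.eventually_ge_atTop 1, eventually_ge_atTop 1]
      with n hcount hslot hdis hg2 hd2 hL hn
    obtain ⟨hμ, hq, hs⟩ := hcount
    have hn0 : (0 : ℝ) < n := by exact_mod_cast hn
    have hδdef : δ n = 4 / (((1 - c) / 2) ^ 2 * Real.log n / (8 * D)) +
      4 * (1 / (1 - Real.exp (-(ε * Real.log n))) ^ 2 - 1) := rfl
    have hw : 0 ≤ D * Real.log n / n := by positivity
    generalize ⌊n / (D * Real.log n)⌋₊ = Q at *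
    have hSS : ∀ k l : ℕ, k < l → l < Q → Disjoint (S n k) (S n l) := by
      intro k l hkl hl
      rw [Set.disjoint_left]
      intro y hyk hyl
      have h1 := ((hslot k (hkl.trans hl)).2.2.2 hyk).2
      have h2 := ((hslot l hl).2.2.2 hyl).1
      have h3 : (k : ℝ) + 1 ≤ l := by exact_mod_cast hkl
      have h4 := mul_le_mul_of_nonneg_right h3 hw
      linarith
    have main := measureReal_at_most_one_occupied_le (n := n) (Q := Q)
      (C := fun k => C n k) (S := fun k => S n k) (s := c * Real.log n / n)
      (h := ε * Real.log n / n) (fun k => hC n k) (fun k => hS n k)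
      (fun k => (hslot k k.2).1) (fun k => (hslot k k.2).2.1) hs
      (fun k => (hslot k k.2).2.2.1)
      (fun k l hkl => by
        rcases lt_or_gt_of_ne hkl with h | h
        · exact hSS k l h l.2
        · exact (hSS l k h k.2).symm)
      (by linarith)
    have hfew : (positionLaw n).real {X | ∀ k l : Fin Q, X ∈ occupiedNextTo n (C n k) (S n k) →
        X ∈ occupiedNextTo n (C n l) (S n l) → k = l} ≤ δ n := by
      refine main.trans ?_
      generalize (1 - c * Real.log n / n) ^ n -
        (1 - c * Real.log n / n - ε * Real.log n / n) ^ n = p at *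
      generalize (1 - 2 * (c * Real.log n / n)) ^ n = q at *
      rw [hδdef]
      have hd0 := Real.exp_pos (-(ε * Real.log n))
      generalize Real.exp (-(ε * Real.log n)) = d at *
      generalize ((1 - c) / 2) ^ 2 * Real.log n / (8 * D) = g at *
      have hd1 : 0 < (1 - d) ^ 2 := pow_pos (by linarith) 2
      have he : 1 ≤ 1 / (1 - d) ^ 2 := by
        rw [le_div_iff₀ hd1]
        nlinarith
      rw [← le_div_iff₀ hd1] at hq
      have hQq : (Q : ℝ) ^ 2 * q ≤ (Q * p) ^ 2 * (1 / (1 - d) ^ 2) := by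
        calc (Q : ℝ) ^ 2 * q ≤ Q ^ 2 * (p ^ 2 / (1 - d) ^ 2) := by gcongr
          _ = _ := by ring
      have hμ2 : 2 ≤ Q * p := by linarith
      generalize (Q : ℝ) * p = μ at *
      generalize (Q : ℝ) ^ 2 * q = y at *
      have hg : 0 < g := by linarith
      have h6 : 4 / μ ≤ 4 / g := by gcongr
      have hgoal : (μ + y - μ ^ 2) / (μ - 1) ^ 2 ≤ 4 / μ + 4 * (1 / (1 - d) ^ 2 - 1) := by
        generalize 1 / (1 - d) ^ 2 = e at *
        have h7 : 0 ≤ 4 / μ + 4 * (e - 1) := by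
          have : 0 < 4 / μ := by positivity
          linarith
        have h8 : (4 / μ + 4 * (e - 1)) * (μ ^ 2 / 4) = μ + μ ^ 2 * e - μ ^ 2 := by
          field_simp
          ring
        -- This is where a mean of at least `2` is needed.
        have h9 : μ ^ 2 / 4 ≤ (μ - 1) ^ 2 := by nlinarith
        rw [div_le_iff₀ (by nlinarith)]
        linarith [mul_le_mul_of_nonneg_left h9 h7]
      linarith
    refine tsub_le_iff_right.2 ?_
    have hcover : ∀ᵐ X ∂positionLaw n, X ∈ {X | ¬ (graph n (r₁ n) (r₂ n) X).Connected} ∪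
        {X | ∀ k l : Fin Q, X ∈ occupiedNextTo n (C n k) (S n k) →
          X ∈ occupiedNextTo n (C n l) (S n l) → k = l} := by
      filter_upwards [ae_mem_Icc n] with X hX
      by_contra hno
      simp only [Set.mem_union, Set.mem_ofPred_eq, not_or, not_not, not_forall] at hno
      obtain ⟨hcon, k, l, hk, hl, hkl⟩ := hno
      rcases lt_or_gt_of_ne hkl with h | h
      · exact hdis k l h l.2 X hX hk hl hcon
      · exact hdis l k h k.2 X hX hl hk hcon
    calc (1 : ENNReal) = positionLaw n _ := by
          rw [← measure_univ (μ := positionLaw n)]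
          exact (measure_congr (eventuallyEq_univ.2 hcover)).symm
      _ ≤ _ := (measure_union_le _ _).trans (add_le_add le_rfl ?_)
    rw [← ofReal_measureReal]
    exact ENNReal.ofReal_le_ofReal hfew
  refine tendsto_of_tendsto_of_tendsto_of_le_of_le' ?_ tendsto_const_nhds hlow
    (Eventually.of_forall fun n => prob_le_one)
  have h0 : Tendsto (fun n => ENNReal.ofReal (δ n)) atTop (𝓝 0) := by
    simpa using ENNReal.tendsto_ofReal hδ
  simpa using ENNReal.Tendsto.sub (tendsto_const_nhds (x := (1 : ENNReal))) h0 (by simp)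

end Necessary

/-! ### The two obstructions: a pair of gaps, and an isolated vertex -/

section Disconnected

theorem not_connected_of_cut {V : Type*} {G : SimpleGraph V} (U : Set V) {i j : V} (hi : i ∈ U)
    (hj : j ∉ U) (h : ∀ u ∈ U, ∀ v ∉ U, ¬ G.Adj u v) : ¬ G.Connected := by
  intro hG
  obtain ⟨p⟩ := hG.preconnected i j
  obtain ⟨d, -, h1, h2⟩ := p.exists_boundary_dart U hi hj
  exact h _ h1 _ h2 d.adj

theorem slot_le_one {D L : ℝ} {n k : ℕ} (hD : 0 < D) (hL : 0 < L) (hn : 0 < n)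
    (hk : k < ⌊n / (D * L)⌋₊) : (k + 1) * (D * L / n) ≤ 1 := by
  have hn0 : (0 : ℝ) < n := by exact_mod_cast hn
  have h1 : ((k + 1 : ℕ) : ℝ) ≤ n / (D * L) := (Nat.le_floor_iff (by positivity)).1 hk
  push_cast at h1
  calc (k + 1) * (D * L / n) ≤ n / (D * L) * (D * L / n) := by gcongr
    _ = 1 := by field_simp

/-- Two gaps longer than the maximal edge length separate the points between them from the
others. -/
theorem not_connected_of_two_gaps {n : ℕ} {r₁ r₂ u v h : ℝ} {X : Fin n → ℝ} (hr : 0 ≤ r₂)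
    (hX : ∀ i, X i ∈ Set.Icc (0 : ℝ) 1) (hu : 0 ≤ u) (hh : 0 < h) (huv : u + h + r₂ ≤ v)
    (hv : v + h + r₂ ≤ 1)
    (h1 : X ∈ occupiedNextTo n (Set.Ico u (u + h)) (Set.Ico (u + h) (u + h + r₂)))
    (h2 : X ∈ occupiedNextTo n (Set.Ico v (v + h)) (Set.Ico (v + h) (v + h + r₂))) :
    ¬ (graph n r₁ r₂ X).Connected := by
  obtain ⟨⟨i, hi⟩, hgi⟩ := h1
  obtain ⟨⟨j, hj⟩, hgj⟩ := h2
  -- The occupied cell in front of each gap puts a vertex on either side of the cut: `j` between the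
  -- gaps, `i` before the first.
  refine not_connected_of_cut {l | X l ∈ Set.Ico (u + h + r₂) (v + h)} (i := j) (j := i)
    ⟨huv.trans hj.1, hj.2⟩ (fun hi' => ?_) ?_
  · have := hi'.1
    have := hi.2
    linarith
  · rintro s ⟨hs1, hs2⟩ t ht ⟨-, -, hst⟩
    have ht0 := (hX t).1
    have ht1 := (hX t).2
    have hs0 := (hX s).2
    rcases min_le_iff.1 hst with hst | hst
    · obtain ⟨h3, h4⟩ := abs_le.1 hst
      by_cases h5 : X t < u + h + r₂
      · have h6 : X t < u + h := by
          by_contra! h6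
          exact hgi t ⟨h6, h5⟩
        linarith
      · have h6 : v + h ≤ X t := by
          by_contra! h6
          exact ht ⟨by linarith, h6⟩
        have h7 : v + h + r₂ ≤ X t := by
          by_contra! h7
          exact hgj t ⟨h6, h7⟩
        linarith
    · have h3 : 1 - r₂ ≤ |X s - X t| := by linarith
      rcases le_abs.1 h3 with h4 | h4 <;> linarith

theorem tendsto_prob_not_connected_of_lt_one {a b : ℝ} (ha0 : 0 ≤ a) (ha : a < 1) :
    Tendsto (fun n : ℕ => prob n (b * Real.log n / n) (a * Real.log n / n)
      (fun G => ¬ G.Connected)) atTop (𝓝 1) := by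
  have hD : 0 < a + 1 := by linarith
  let u : ℕ → ℕ → ℝ := fun n k => k * ((a + 1) * Real.log n / n)
  have hsize : ∀ n k : ℕ, 1 < n → k < ⌊n / ((a + 1) * Real.log n)⌋₊ →
      0 ≤ a * Real.log n / n ∧ 0 < Real.log n / n ∧ 0 ≤ u n k ∧
      u n k + Real.log n / n + a * Real.log n / n = (k + 1) * ((a + 1) * Real.log n / n) ∧
      u n k + Real.log n / n + a * Real.log n / n ≤ 1 := by
    intro n k hn hk
    have hL : 0 < Real.log n := Real.log_pos (by exact_mod_cast hn)
    have hn0 : (0 : ℝ) < n := by positivity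
    have h1 : u n k + Real.log n / n + a * Real.log n / n =
        (k + 1) * ((a + 1) * Real.log n / n) := by
      simp only [u]
      ring
    refine ⟨by positivity, by positivity, by positivity, h1, ?_⟩
    rw [h1]
    exact slot_le_one hD hL (by omega) hk
  refine tendsto_prob_not_connected_of_slots ha0 ha one_pos hD
    (C := fun n k => Set.Ico (u n k) (u n k + Real.log n / n))
    (S := fun n k => Set.Ico (u n k + Real.log n / n)
      (u n k + Real.log n / n + a * Real.log n / n))
    (fun n k => measurableSet_Ico) (fun n k => measurableSet_Ico) ?_ ?_
  · filter_upwards [eventually_gt_atTop 1] with n hn k hk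
    obtain ⟨h1, h2, h3, h4, h5⟩ := hsize n k hn hk
    refine ⟨?_, ?_, ?_, ?_⟩
    · rw [measureReal_unif_Ico h3 (by linarith) (by linarith)]
      ring
    · rw [measureReal_unif_Ico (by linarith) (by linarith) (by linarith)]
      ring
    · rw [Set.disjoint_left]
      intro y hy hy'
      exact absurd hy'.2 (not_lt.2 hy.1)
    · rw [h4]
      exact Set.Ico_subset_Ico_left (by change u n k ≤ _; linarith)
  · filter_upwards [eventually_gt_atTop 1] with n hn k l hkl hl X hX h1 h2
    obtain ⟨k1, k2, k3, k4, k5⟩ := hsize n k hn (hkl.trans hl)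
    obtain ⟨l1, l2, l3, l4, l5⟩ := hsize n l hn hl
    refine not_connected_of_two_gaps k1 hX k3 k2 ?_ l5 h1 h2
    rw [k4]
    refine mul_le_mul_of_nonneg_right ?_ (div_nonneg (mul_nonneg hD.le ?_) (Nat.cast_nonneg n))
    · exact_mod_cast hkl
    · exact Real.log_natCast_nonneg n

/-- A point all of whose potential neighbours are missing is isolated. -/
theorem not_connected_of_isolated {n : ℕ} {r₁ r₂ u h : ℝ} {X : Fin n → ℝ} (hn : 1 < n)
    (hX : ∀ i, X i ∈ Set.Icc (0 : ℝ) 1) (hu : 0 ≤ u) (hh : 0 < h)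
    (hu1 : u + 2 * r₂ + 2 * h ≤ 1)
    (h1 : X ∈ occupiedNextTo n (Set.Ico (u + h + r₂) (u + h + r₂ + h))
      (Set.Ico (u + h) (u + h + (r₂ - r₁ + h)) ∪
        Set.Ico (u + h + r₂ + r₁) (u + h + r₂ + r₁ + (r₂ - r₁ + h)))) :
    ¬ (graph n r₁ r₂ X).Connected := by
  obtain ⟨⟨i, hi1, hi2⟩, hgap⟩ := h1
  have : Nontrivial (Fin n) := Fin.nontrivial_iff_two_le.2 hn
  obtain ⟨j, hj⟩ := exists_ne i
  refine not_connected_of_cut {i} (Set.mem_singleton i) (j := j) hj ?_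
  rintro s hs t - ⟨-, hst1, hst2⟩
  rw [Set.mem_singleton_iff] at hs
  subst hs
  have ht0 := (hX t).1
  have ht1 := (hX t).2
  have hst3 : r₁ ≤ |X s - X t| := hst1.trans (min_le_left _ _)
  rcases min_le_iff.1 hst2 with hst | hst
  · obtain ⟨h3, h4⟩ := abs_le.1 hst
    rcases le_abs.1 hst3 with h5 | h5
    · exact hgap t (Or.inl ⟨by linarith, by linarith⟩)
    · exact hgap t (Or.inr ⟨by linarith, by linarith⟩)
  -- No edge wraps around the end points: the vertex is at distance more than `r₂` from both `0` and
  -- `1`, the former thanks to the margin `h > 0` at the left of the slot.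
  · have h3 : 1 - r₂ ≤ |X s - X t| := by linarith
    rcases le_abs.1 h3 with h4 | h4 <;> linarith

theorem tendsto_prob_not_connected_of_sub_lt_half {a b : ℝ} (hb : 0 < b) (hba : b ≤ a)
    (hab : a - b < 1 / 2) :
    Tendsto (fun n : ℕ => prob n (b * Real.log n / n) (a * Real.log n / n)
      (fun G => ¬ G.Connected)) atTop (𝓝 1) := by
  -- `ε ≤ b` keeps the left part of the region off the cell; the second bound gives `c = 2 * (a - b
  -- + ε) < 1`.
  obtain ⟨ε, hε, hεb, hεab⟩ : ∃ ε > 0, ε ≤ b ∧ 2 * ε ≤ 1 / 2 - (a - b) :=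
    ⟨min b ((1 / 2 - (a - b)) / 2), lt_min hb (by linarith), min_le_left _ _, by
      linarith [min_le_right b ((1 / 2 - (a - b)) / 2)]⟩
  have hD : 0 < 2 * a + 2 * ε := by linarith
  let u : ℕ → ℕ → ℝ := fun n k => k * ((2 * a + 2 * ε) * Real.log n / n)
  have hsize : ∀ n k : ℕ, 1 < n → k < ⌊n / ((2 * a + 2 * ε) * Real.log n)⌋₊ →
      0 < ε * Real.log n / n ∧ ε * Real.log n / n ≤ b * Real.log n / n ∧
      b * Real.log n / n ≤ a * Real.log n / n ∧ 0 ≤ u n k ∧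
      u n k + 2 * (a * Real.log n / n) + 2 * (ε * Real.log n / n) =
        (k + 1) * ((2 * a + 2 * ε) * Real.log n / n) ∧
      u n k + 2 * (a * Real.log n / n) + 2 * (ε * Real.log n / n) ≤ 1 := by
    intro n k hn hk
    have hL : 0 < Real.log n := Real.log_pos (by exact_mod_cast hn)
    have hn0 : (0 : ℝ) < n := by positivity
    have h1 : u n k + 2 * (a * Real.log n / n) + 2 * (ε * Real.log n / n) =
        (k + 1) * ((2 * a + 2 * ε) * Real.log n / n) := by
      simp only [u]
      ring
    refine ⟨by positivity, by gcongr, by gcongr, by positivity, h1, ?_⟩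
    rw [h1]
    exact slot_le_one hD hL (by omega) hk
  refine tendsto_prob_not_connected_of_slots (c := 2 * (a - b + ε)) (by linarith) (by linarith)
    hε hD
    (C := fun n k => Set.Ico (u n k + ε * Real.log n / n + a * Real.log n / n)
      (u n k + ε * Real.log n / n + a * Real.log n / n + ε * Real.log n / n))
    (S := fun n k => Set.Ico (u n k + ε * Real.log n / n) (u n k + ε * Real.log n / n +
        (a * Real.log n / n - b * Real.log n / n + ε * Real.log n / n)) ∪
      Set.Ico (u n k + ε * Real.log n / n + a * Real.log n / n + b * Real.log n / n)
        (u n k + ε * Real.log n / n + a * Real.log n / n + b * Real.log n / n +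
          (a * Real.log n / n - b * Real.log n / n + ε * Real.log n / n)))
    (fun n k => measurableSet_Ico) (fun n k => measurableSet_Ico.union measurableSet_Ico) ?_ ?_
  · filter_upwards [eventually_gt_atTop 1] with n hn k hk
    obtain ⟨h1, h2, h3, h4, h5, h6⟩ := hsize n k hn hk
    refine ⟨?_, ?_, ?_, ?_⟩
    · rw [measureReal_unif_Ico (by linarith) (by linarith) (by linarith)]
      ring
    · rw [measureReal_union _ measurableSet_Ico,
        measureReal_unif_Ico (by linarith) (by linarith) (by linarith),
        measureReal_unif_Ico (by linarith) (by linarith) (by linarith)]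
      · ring
      · rw [Set.disjoint_left]
        rintro y ⟨-, hy⟩ ⟨hy', -⟩
        linarith
    · rw [Set.disjoint_left]
      rintro y (⟨hy1, hy2⟩ | ⟨hy1, hy2⟩) ⟨hy3, hy4⟩ <;> linarith
    · rw [← h5]
      change _ ⊆ Set.Ico (u n k) _
      exact Set.union_subset (Set.Ico_subset_Ico (by linarith) (by linarith))
        (Set.Ico_subset_Ico (by linarith) (by linarith))
  · filter_upwards [eventually_gt_atTop 1] with n hn k l hkl hl X hX h1 _
    obtain ⟨k1, k2, k3, k4, k5, k6⟩ := hsize n k hn (hkl.trans hl)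
    exact not_connected_of_isolated hn hX k4 k1 k6 h1

end Disconnected

end VRG

theorem theorem1 (a b : ℝ) (hb : 0 ≤ b) (hab : b ≤ a) :
    (1 < a ∧ 1 / 2 < a - b →
      Tendsto (fun n : ℕ =>
          VRG.prob n (b * Real.log n / n) (a * Real.log n / n) (fun G => G.Connected))
        atTop (𝓝 1)) ∧
    (a < 1 ∨ a - b < 1 / 2 →
      Tendsto (fun n : ℕ =>
          VRG.prob n (b * Real.log n / n) (a * Real.log n / n) (fun G => ¬ G.Connected))
        atTop (𝓝 1)) := by
  refine ⟨fun h => VRG.tendsto_prob_connected hb h.1 h.2, fun h => ?_⟩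
  -- When `a ≥ 1`, the condition `a - b < 1 / 2` forces `b > 0`, as the isolated vertex argument
  -- requires.
  by_cases ha : a < 1
  · exact VRG.tendsto_prob_not_connected_of_lt_one (hb.trans hab) ha
  · have hab' : a - b < 1 / 2 := h.resolve_left ha
    exact VRG.tendsto_prob_not_connected_of_sub_lt_half (by linarith) hab hab'
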